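/- **Theorem (Continuity of $G$-causal optimization problems).** Let $G=(V,E)$, $V=\{1,\dots,d\}$, be a sorted DAG (that is, $(i,j)\in E$ implies $i<j$). For $A\subseteq V$ put $\mathrm{PA}(A)=\{i\in V\setminus A : \exists j\in A,\ (i,j)\in E\}$, $\mathrm{PA}(i)=\mathrm{PA}(\{i\})$, and $x_A=(x_i)_{i\in A}$ for $x\in\mathbb{R}^d$. A Borel probability measure $\mu$ on $\mathbb{R}^d$ is *$G$-compatible* if it is the law of a random vector $X$ with $X_i=f_i(X_{\mathrm{PA}(i)},U_i)$ a.s., $i=1,\dots,d$, for some measurable $f_i$ and mutually independent real random variables $U_1,\dots,U_d$. Let $\mathcal{P}_{G,1}(\mathbb{R}^d)$ be the set of $G$-compatible distributions with finite first moment. A coupling $\pi$ of $\mu,\nu\in\mathcal{P}_{G,1}(\mathbb{R}^d)$ is *$G$-causal* if there are $(X,X')\sim\pi$, measurable $g_i$ and real random variables $U_1,\dots,U_d$ such that $X,U_1,\dots,U_d$ are mutually independent and $X'_i=g_i(X_i,X_{\mathrm{PA}(i)},X'_{\mathrm{PA}(i)},U_i)$ a.s. for all $i$; it is *$G$-bicausal*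 if the law of $(X',X)$ is $G$-causal as well. Let $$W_G(\mu,\nu)=\inf_{\pi}\int\|x-x'\|\,\pi(dx,dx'),$$ the infimum being over all $G$-bicausal couplings of $\mu$ and $\nu$, with $\|\cdot\|$ the Euclidean norm. Let $T\subseteq V$ be such that the quotient of $G$ by the partition $\{T\}\cup\{\{i\}:i\in V\setminus T\}$ (with an edge between two distinct classes whenever $G$ has an edge between some of their members) is a DAG. Let $m\ge 0$ (for instance $m=|T|$), let $L\ge 0$, and let $Q:\mathbb{R}^{|T|}\times\mathbb{R}^{m}\to[-\infty,\infty]$ be Borel measurable such that * for every $h\in\mathbb{R}^m$, the function $x\mapsto Q(x,h)$ is locally $L$-Lipschitz, with the same constant $L$ for all $h$: every point of $\mathbb{R}^{|T|}$ has a neighbourhood $U$ with $Q(y,h)\le Q(z,h)+L\|y-z\|$ for all $y,z\in U$; * for every $x\in\mathbb{R}^{|T|}$, the function $h\mapsto Q(x,h)$ is convex (its epigraph $\{(h,r)\in\mathbb{R}^m\times\mathbb{R}: Q(x,h)\le r\}$ is convex). Call a Borel measurable function $h:\mathbb{R}^{|V\setminus T|}\to\mathbb{R}^{m}$ *$G$-causal*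 if $h(x)$ depends only on $x_{\mathrm{PA}(T)}$, and put $$\mathcal{V}(\mu)=\inf_{h\ G\text{-causal}}\mathbb{E}_\mu\big[Q(X_T,h(X_{V\setminus T}))\big]\in[-\infty,\infty],$$ where $\mathbb{E}[Z]=\mathbb{E}[Z^+]-\mathbb{E}[Z^-]$ with $\infty-\infty=\infty$. Then $\mathcal{V}$ is continuous on $\mathcal{P}_{G,1}(\mathbb{R}^d)$ with respect to $W_G$: for every $\mu\in\mathcal{P}_{G,1}(\mathbb{R}^d)$, $\mathcal{V}(\nu)\to\mathcal{V}(\mu)$ in $[-\infty,\infty]$ as $W_G(\mu,\nu)\to0$, $\nu\in\mathcal{P}_{G,1}(\mathbb{R}^d)$. Moreover, for all $\mu,\nu\in\mathcal{P}_{G,1}(\mathbb{R}^d)$, $$\mathcal{V}(\mu)\le\mathcal{V}(\nu)+L\,W_G(\mu,\nu)\quad\text{and}\quad\mathcal{V}(\nu)\le\mathcal{V}(\mu)+L\,W_G(\mu,\nu),$$ so that $|\mathcal{V}(\mu)-\mathcal{V}(\nu)|\le L\,W_G(\mu,\nu)$ whenever these values are finite. -/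

import Mathlib

open MeasureTheory ProbabilityTheory Filter Topology
open scoped NNReal ENNReal

namespace GCausal

/-! ### Graphs -/

/-- A directed graph is acyclic (a DAG) if no vertex can be reached from itself by a directed
path of positive length. -/
def IsAcyclic {V : Type*} (G : Digraph V) : Prop :=
  ∀ v, ¬ Relation.TransGen G.Adj v v

/-- A sorted DAG on the vertices `0, …, d - 1`: every edge goes from a smaller to a larger vertex. -/
def IsSortedDAG {d : ℕ} (G : Digraph (Fin d)) : Prop :=
  IsAcyclic G ∧ ∀ i j, G.Adj i j → i < j

open Classical in
/-- The parents of a set of vertices `A`: the vertices outside `A` with an edge into `A`. -/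
noncomputable def parents {d : ℕ} (G : Digraph (Fin d)) (A : Finset (Fin d)) : Finset (Fin d) :=
  Finset.univ.filter fun i => i ∉ A ∧ ∃ j ∈ A, G.Adj i j

/-- The equivalence relation whose classes are `T` and the singletons `{i}`, `i ∉ T`. -/
def targetSetoid {d : ℕ} (T : Finset (Fin d)) : Setoid (Fin d) where
  r i j := i = j ∨ (i ∈ T ∧ j ∈ T)
  iseqv :=
    { refl := fun _ => Or.inl rfl
      symm := by
        rintro i j (h | ⟨h, h'⟩)
        · exact Or.inl h.symm
        · exact Or.inr ⟨h', h⟩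
      trans := by
        rintro i j k (rfl | ⟨h, h'⟩) (rfl | ⟨h2, h3⟩)
        · exact Or.inl rfl
        · exact Or.inr ⟨h2, h3⟩
        · exact Or.inr ⟨h, h'⟩
        · exact Or.inr ⟨h, h3⟩ }

/-- The quotient of `G` by the partition `{T} ∪ {{i} | i ∉ T}`: there is an edge between two
distinct classes if `G` has an edge between some of their members. -/
def quotientGraph {d : ℕ} (G : Digraph (Fin d)) (T : Finset (Fin d)) :
    Digraph (Quotient (targetSetoid T)) where
  Adj a b := a ≠ b ∧ ∃ i j, Quotient.mk (targetSetoid T) i = a ∧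
    Quotient.mk (targetSetoid T) j = b ∧ G.Adj i j

/-! ### Distributions and couplings -/

/-- The slice `x_A = (x_i, i ∈ A)` of a vector `x ∈ ℝᵈ`. -/
noncomputable def slice {d : ℕ} (A : Finset (Fin d)) (x : EuclideanSpace ℝ (Fin d)) :
    EuclideanSpace ℝ A :=
  WithLp.toLp 2 fun i : A => x i

/-- `μ` is `G`-compatible: it is the law of a random vector that solves a structural causal model
`X_i = f_i (X_{PA(i)}, U_i)` with mutually independent noise variables `U_i`. -/
def IsGCompatible {d : ℕ} (G : Digraph (Fin d)) (μ : Measure (EuclideanSpace ℝ (Fin d))) : Prop :=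
  ∃ (Ω : Type) (_ : MeasurableSpace Ω) (P : Measure Ω) (_ : IsProbabilityMeasure P)
    (X : Ω → EuclideanSpace ℝ (Fin d)) (U : Fin d → Ω → ℝ)
    (f : ∀ i : Fin d, EuclideanSpace ℝ (parents G {i}) → ℝ → ℝ),
    Measurable X ∧ (∀ i, Measurable (U i)) ∧ (∀ i, Measurable (Function.uncurry (f i))) ∧
    P.map X = μ ∧ iIndepFun U P ∧
    ∀ i, ∀ᵐ ω ∂P, X ω i = f i (slice (parents G {i}) (X ω)) (U i ω)

/-- The set `𝒫_{G,1}(ℝᵈ)` of `G`-compatible probability measures with finite first moment. -/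
def compatibleL1 {d : ℕ} (G : Digraph (Fin d)) : Set (Measure (EuclideanSpace ℝ (Fin d))) :=
  {μ | IsProbabilityMeasure μ ∧ IsGCompatible G μ ∧ ∫⁻ x, ‖x‖ₑ ∂μ < ∞}

/-- The law `π` of a pair `(X, X')` is `G`-causal if it can be realised with
`X'_i = g_i (X_i, X_{PA(i)}, X'_{PA(i)}, U_i)`, where `X, U_1, …, U_d` are mutually independent. -/
def IsGCausalLaw {d : ℕ} (G : Digraph (Fin d))
    (π : Measure (EuclideanSpace ℝ (Fin d) × EuclideanSpace ℝ (Fin d))) : Prop :=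
  ∃ (Ω : Type) (_ : MeasurableSpace Ω) (P : Measure Ω) (_ : IsProbabilityMeasure P)
    (X X' : Ω → EuclideanSpace ℝ (Fin d)) (U : Fin d → Ω → ℝ)
    (g : ∀ i : Fin d,
      ℝ × EuclideanSpace ℝ (parents G {i}) × EuclideanSpace ℝ (parents G {i}) × ℝ → ℝ),
    Measurable X ∧ Measurable X' ∧ (∀ i, Measurable (U i)) ∧ (∀ i, Measurable (g i)) ∧
    P.map (fun ω => (X ω, X' ω)) = π ∧
    iIndepFun U P ∧ IndepFun X (fun ω i => U i ω) P ∧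
    ∀ i, ∀ᵐ ω ∂P,
      X' ω i = g i (X ω i, slice (parents G {i}) (X ω), slice (parents G {i}) (X' ω), U i ω)

/-- The set `Π_G^{bc}(μ, ν)` of `G`-bicausal couplings: couplings of `μ` and `ν` for which the
laws of `(X, X')` and of `(X', X)` are both `G`-causal. -/
def bicausalCouplings {d : ℕ} (G : Digraph (Fin d)) (μ ν : Measure (EuclideanSpace ℝ (Fin d))) :
    Set (Measure (EuclideanSpace ℝ (Fin d) × EuclideanSpace ℝ (Fin d))) :=
  {π | π.fst = μ ∧ π.snd = ν ∧ IsGCausalLaw G π ∧ IsGCausalLaw G (π.map Prod.swap)}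

/-- The `G`-causal Wasserstein distance
`W_G(μ, ν) = inf_{π ∈ Π_G^{bc}(μ, ν)} ∫ ‖x - x'‖ π(dx, dx')`. -/
noncomputable def wasserstein {d : ℕ} (G : Digraph (Fin d))
    (μ ν : Measure (EuclideanSpace ℝ (Fin d))) : ℝ≥0∞ :=
  ⨅ π ∈ bicausalCouplings G μ ν, ∫⁻ p, ‖p.1 - p.2‖ₑ ∂π

/-! ### Causal optimization problems -/

open Classical in
/-- The expectation `∫ f⁺ dμ - ∫ f⁻ dμ` of an extended-real-valued function to be minimized, with
the convention `∞ - ∞ = ∞` of minimization problems. -/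
noncomputable def expect {α : Type*} [MeasurableSpace α] (μ : Measure α) (f : α → EReal) : EReal :=
  if ∫⁻ x, (f x).toENNReal ∂μ = ∞ then ⊤
  else ((∫⁻ x, (f x).toENNReal ∂μ : ℝ≥0∞) : EReal) - ((∫⁻ x, (-f x).toENNReal ∂μ : ℝ≥0∞) : EReal)

/-- An extended-real-valued function is convex if its epigraph is convex. -/
def IsConvex {F : Type*} [AddCommGroup F] [Module ℝ F] (f : F → EReal) : Prop :=
  Convex ℝ {p : F × ℝ | f p.1 ≤ (p.2 : EReal)}

/-- Every point has a neighbourhood on which `f` is `L`-Lipschitz. Infinite values are allowed;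
where they occur in such a neighbourhood, `f` is constantly equal to `⊤` or to `⊥` there. -/
def IsLocallyLipschitz {F : Type*} [NormedAddCommGroup F] (L : ℝ≥0) (f : F → EReal) : Prop :=
  ∀ x, ∃ U ∈ 𝓝 x, ∀ y ∈ U, ∀ z ∈ U, f y ≤ f z + (((L : ℝ) * ‖y - z‖ : ℝ) : EReal)

/-- A function `h` of `x_{V ∖ T}` is `G`-causal with respect to `T` if it depends only on
`x_{PA(T)}`. -/
def IsGCausalFun {d : ℕ} (G : Digraph (Fin d)) (T : Finset (Fin d)) {β : Type*}
    (h : EuclideanSpace ℝ (Tᶜ : Finset (Fin d)) → β) : Prop :=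
  ∀ x y, (∀ i : (Tᶜ : Finset (Fin d)), (i : Fin d) ∈ parents G T → x i = y i) → h x = h y

/-- The value `𝒱(μ)` of the `G`-causal optimization problem: the infimum of
`E_μ[Q(X_T, h(X_{V ∖ T}))]` over all (Borel measurable) `G`-causal functions `h`. -/
noncomputable def value {d : ℕ} (G : Digraph (Fin d)) (T : Finset (Fin d)) {κ : Type*} [Fintype κ]
    (Q : EuclideanSpace ℝ T → EuclideanSpace ℝ κ → EReal)
    (μ : Measure (EuclideanSpace ℝ (Fin d))) : EReal :=
  ⨅ (h : EuclideanSpace ℝ (Tᶜ : Finset (Fin d)) → EuclideanSpace ℝ κ)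
    (_ : Measurable h ∧ IsGCausalFun G T h),
    expect μ fun x => Q (slice T x) (h (slice Tᶜ x))

end GCausal

/-! Fix a causal decision `h` for `ν` and a bicausal coupling of `X ∼ μ` and `X' ∼ ν`. Facing the
target `X_T` instead of `X'_T` with the decision `h(X'_{PA(T)})` costs at most `L‖X - X'‖` more,
since local Lipschitz bounds add up along segments (`IsLocallyLipschitz.le_add`). This decision is
not a function of `X_{PA(T)}`, so it has to be derandomized.

Let `N` be the set of nondescendants of `T`. It is ancestral, and acyclicity of the quotient puts
`PA(T)` inside it. Causality of the coupling then makes `X'_N`, hence the decision, a function of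
`X_N` and of noise `U` independent of `X`. Compatibility of `μ` makes `X_T` a function of
`X_{PA(T)}` and of noise that may be taken independent of `(X_N, U)`. Hence, given `X_{PA(T)}`, the
decision carries no information on `X_T`: it can be resampled from `X_{PA(T)}` and an independent
uniform variable `v`, and the infimum over fixed `v` does not exceed the average
(`iInf_expect_comp_le`, applied in `IsGCausalLaw.iInf_expect_le`).

Optimizing over `h` and the coupling gives one inequality, symmetry of `W_G` the other, and
continuity follows by squeezing. -/

namespace GCausal

/-! ### Extended-valued expectations and derandomization. -/

section Expect
variable {α β : Type*} [MeasurableSpace α] [MeasurableSpace β]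

lemma expect_map (μ : Measure α) {φ : α → β} (hφ : Measurable φ) {f : β → EReal}
    (hf : Measurable f) : expect (μ.map φ) f = expect μ fun x => f (φ x) := by
  unfold expect
  rw [lintegral_map (f := fun x => (f x).toENNReal) (by fun_prop) hφ,
    lintegral_map (f := fun x => (-f x).toENNReal) (by fun_prop) hφ]

lemma expect_congr_ae {μ : Measure α} {f g : α → EReal} (h : f =ᵐ[μ] g) :
    expect μ f = expect μ g := by
  unfold expect
  have h1 : ∫⁻ x, (f x).toENNReal ∂μ = ∫⁻ x, (g x).toENNReal ∂μ :=
    lintegral_congr_ae (h.mono fun x hx => by simp only [hx])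
  have h2 : ∫⁻ x, (-f x).toENNReal ∂μ = ∫⁻ x, (-g x).toENNReal ∂μ :=
    lintegral_congr_ae (h.mono fun x hx => by simp only [hx])
  rw [h1, h2]

/-- Moving negative parts across turns `a ≤ b + c` into a subtraction-free inequality in `[0, ∞]`,
which can be integrated without integrability assumptions. -/
lemma toENNReal_add_le_of_le_add {a b : EReal} {c : ℝ≥0} (h : a ≤ b + ((c : ℝ) : EReal)) :
    a.toENNReal + (-b).toENNReal ≤ b.toENNReal + (-a).toENNReal + c := by
  induction a with
  | bot => simp
  | top =>
    induction b with
    | bot => simp at h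
    | top => simp
    | coe b => exact absurd h (not_le.2 (by rw [← EReal.coe_add]; exact EReal.coe_lt_top _))
  | coe a =>
    induction b with
    | bot => simp at h
    | top => simp
    | coe b =>
      rw [← EReal.coe_add, EReal.coe_le_coe_iff] at h
      rw [← EReal.coe_neg, ← EReal.coe_neg]
      simp only [EReal.real_coe_toENNReal, ENNReal.ofReal]
      norm_cast
      rw [← NNReal.coe_le_coe]
      push_cast [Real.coe_toNNReal']
      have := c.2
      rcases max_cases a 0 with h1 | h1 <;> rcases max_cases (-b) 0 with h2 | h2 <;>
        rcases max_cases b 0 with h3 | h3 <;> rcases max_cases (-a) 0 with h4 | h4 <;> linarith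

lemma sub_le_sub_add_of_add_le {a b a' b' : ℝ≥0∞} {c : ℝ≥0∞} (ha : a ≠ ∞) (hb : b ≠ ∞)
    (hc : c ≠ ∞) (h : a + b' ≤ b + a' + c) :
    (a : EReal) - (a' : EReal) ≤ ((b : EReal) - (b' : EReal)) + (c : EReal) := by
  lift a to ℝ≥0 using ha
  lift b to ℝ≥0 using hb
  lift c to ℝ≥0 using hc
  induction a' with
  | top => simp
  | coe a' =>
    induction b' with
    | top =>
      rw [add_top, top_le_iff] at h
      exact absurd h (by norm_cast)
    | coe b' =>
      have h' : (a : ℝ) + b' ≤ b + a' + c := by exact_mod_cast h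
      change (((a : ℝ) : EReal)) - ((a' : ℝ) : EReal) ≤
        (((b : ℝ) : EReal) - ((b' : ℝ) : EReal)) + ((c : ℝ) : EReal)
      rw [← EReal.coe_sub, ← EReal.coe_sub, ← EReal.coe_add, EReal.coe_le_coe_iff]
      linarith

/-- Monotonicity of the expectation, up to an integrable error. -/
lemma expect_le_expect_add {μ : Measure α} {f g : α → EReal} {c : α → ℝ≥0}
    (hf : Measurable f) (hg : Measurable g) (hcfin : ∫⁻ x, c x ∂μ ≠ ∞)
    (h : ∀ x, f x ≤ g x + ((c x : ℝ) : EReal)) :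
    expect μ f ≤ expect μ g + ((∫⁻ x, c x ∂μ : ℝ≥0∞) : EReal) := by
  have key : ∫⁻ x, (f x).toENNReal ∂μ + ∫⁻ x, (-g x).toENNReal ∂μ ≤
      ∫⁻ x, (g x).toENNReal ∂μ + ∫⁻ x, (-f x).toENNReal ∂μ + ∫⁻ x, c x ∂μ := by
    rw [← lintegral_add_left (by fun_prop), ← lintegral_add_left (by fun_prop),
      ← lintegral_add_left (by fun_prop)]
    exact lintegral_mono fun x => toENNReal_add_le_of_le_add (h x)
  have hle : ∫⁻ x, (f x).toENNReal ∂μ ≤ ∫⁻ x, (g x).toENNReal ∂μ + ∫⁻ x, c x ∂μ := by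
    rw [← lintegral_add_left (by fun_prop)]
    refine lintegral_mono fun x => (EReal.toENNReal_le_toENNReal (h x)).trans ?_
    refine EReal.toENNReal_add_le.trans ?_
    rw [EReal.real_coe_toENNReal, ENNReal.ofReal_coe_nnreal]
  unfold expect
  by_cases hgt : ∫⁻ x, (g x).toENNReal ∂μ = ∞
  · rw [if_pos hgt, EReal.top_add_of_ne_bot (by simp)]
    exact le_top
  · have hft : ∫⁻ x, (f x).toENNReal ∂μ ≠ ∞ :=
      ne_top_of_le_ne_top (ENNReal.add_ne_top.2 ⟨hgt, hcfin⟩) hle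
    rw [if_neg hgt, if_neg hft]
    exact sub_le_sub_add_of_add_le hft hgt hcfin key

lemma coe_le_sub_iff {r : ℝ} {a b : ℝ≥0∞} (ha : a ≠ ∞) :
    (r : EReal) ≤ (a : EReal) - (b : EReal) ↔
      b + ENNReal.ofReal r ≤ a + ENNReal.ofReal (-r) := by
  lift a to ℝ≥0 using ha
  induction b with
  | top =>
    simp [ENNReal.ofReal]
  | coe b =>
    change (r : EReal) ≤ ((a : ℝ) : EReal) - ((b : ℝ) : EReal) ↔ _
    simp only [ENNReal.ofReal]
    rw [← EReal.coe_sub, EReal.coe_le_coe_iff]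
    norm_cast
    rw [← NNReal.coe_le_coe]
    push_cast [Real.coe_toNNReal']
    rcases max_cases r 0 with h1 | h1 <;> rcases max_cases (-r) 0 with h2 | h2 <;>
      constructor <;> intro h <;> linarith

/-- The infimum of the expectations of the sections of `f` is at most the expectation of `f`. -/
lemma iInf_expect_le_expect_prod (lam : Measure α) [IsProbabilityMeasure lam] (θ : Measure β)
    [SFinite θ] {f : α × β → EReal} (hf : Measurable f) :
    ⨅ v, expect θ (fun x => f (v, x)) ≤ expect (lam.prod θ) f := by
  -- Testing against real `r` below the infimum gives a subtraction-free bound on each section, so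
  -- that Tonelli applies separately to the positive and negative parts.
  refine EReal.ge_of_forall_gt_iff_ge.1 fun r hr => ?_
  have hsec : ∀ v, ∫⁻ x, (-f (v, x)).toENNReal ∂θ + ENNReal.ofReal r ≤
      ∫⁻ x, (f (v, x)).toENNReal ∂θ + ENNReal.ofReal (-r) := fun v => by
    have h := hr.le.trans (iInf_le _ v)
    unfold expect at h
    split_ifs at h with hv
    · rw [hv, top_add]
      exact le_top
    · exact (coe_le_sub_iff hv).1 h
  have hint := lintegral_mono (μ := lam) hsec
  rw [lintegral_add_right _ measurable_const, lintegral_add_right _ measurable_const,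
    lintegral_const, lintegral_const, measure_univ, mul_one, mul_one,
    ← lintegral_prod (fun z => (-f z).toENNReal) (by fun_prop),
    ← lintegral_prod (fun z => (f z).toENNReal) (by fun_prop)] at hint
  unfold expect
  split_ifs with h
  · exact le_top
  · exact (coe_le_sub_iff h).2 hint

/-- **Derandomization.** If `H` depends on `w` only, a decision `H w` can be replaced by a
deterministic function `η` of the observed part `p w` of `w` without increasing the expected cost,
provided that the remaining part of the cost is a function of `p w` and of independent noise. -/
lemma iInf_expect_comp_le {W P S A B : Type*} [MeasurableSpace W] [MeasurableSpace P]
    [MeasurableSpace S] [MeasurableSpace A] [MeasurableSpace B] [StandardBorelSpace B] [Nonempty B]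
    (ρ : Measure W) [IsProbabilityMeasure ρ] (τ : Measure S) [IsProbabilityMeasure τ]
    {p : W → P} (hp : Measurable p) {H : W → B} (hH : Measurable H)
    {K : P × S → A} (hK : Measurable K) {q : A → B → EReal}
    (hq : Measurable (Function.uncurry q)) :
    ⨅ (η : P → B) (_ : Measurable η),
        expect (ρ.prod τ) (fun z => q (K (p z.1, z.2)) (η (p z.1))) ≤
      expect (ρ.prod τ) (fun z => q (K (p z.1, z.2)) (H z.1)) := by
  have hpH : Measurable fun w => (p w, H w) := hp.prodMk hH
  have := Measure.isProbabilityMeasure_map (μ := ρ) hp.aemeasurable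
  have := Measure.isProbabilityMeasure_map (μ := ρ) hpH.aemeasurable
  -- The conditional law of `H` given `p` is sampled as `φ p v` with `v` uniform.
  obtain ⟨φ, hφ, hφκ⟩ := Kernel.exists_measurable_map_eq_unitInterval
    (ρ.map fun w => (p w, H w)).condKernel
  have hφ' : Measurable fun z : P × unitInterval => φ z.1 z.2 := hφ
  have hlaw : ρ.map (fun w => (p w, H w)) =
      ((ρ.map p).prod (volume : Measure unitInterval)).map fun z => (z.1, φ z.1 z.2) := by
    rw [← (ρ.map fun w => (p w, H w)).disintegrate (ρ.map fun w => (p w, H w)).condKernel]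
    have hfst : (ρ.map fun w => (p w, H w)).fst = ρ.map p := by
      rw [Measure.fst, Measure.map_map measurable_fst hpH]; rfl
    rw [hfst]
    ext s hs
    rw [Measure.compProd_apply hs, Measure.map_apply (by fun_prop) hs,
      Measure.prod_apply (hs.preimage (by fun_prop))]
    refine lintegral_congr fun a => ?_
    rw [← hφκ, Measure.map_apply (by fun_prop) (hs.preimage (by fun_prop))]
    rfl
  have hq' : Measurable fun z : A × B => q z.1 z.2 := hq
  -- The cost depends on `w` only through `(p w, H w)`, so `H w` may be resampled; `v` is moved to
  -- the outer factor in order to be frozen.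
  have hrhs : expect (ρ.prod τ) (fun z => q (K (p z.1, z.2)) (H z.1)) =
      expect ((volume : Measure unitInterval).prod ((ρ.map p).prod τ))
        (fun z => q (K (z.2.1, z.2.2)) (φ z.2.1 z.1)) := by
    have h1 : expect ((ρ.map fun w => (p w, H w)).prod τ) (fun z => q (K (z.1.1, z.2)) z.1.2) =
        expect (ρ.prod τ) (fun z => q (K (p z.1, z.2)) (H z.1)) := by
      rw [← Measure.map_id (μ := τ), Measure.map_prod_map _ _ hpH measurable_id, Measure.map_id,
        expect_map _ (by fun_prop) (by fun_prop)]
      rfl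
    have h2 : (volume : Measure unitInterval).prod ((ρ.map p).prod τ) =
        (((ρ.map p).prod (volume : Measure unitInterval)).prod τ).map
          fun z => (z.1.2, (z.1.1, z.2)) := by
      have h3 : ((volume : Measure unitInterval).prod (ρ.map p)).prod τ =
          (((ρ.map p).prod (volume : Measure unitInterval)).prod τ).map
            (Prod.map Prod.swap id) := by
        rw [← Measure.map_prod_map _ _ measurable_swap measurable_id, Measure.map_id,
          Measure.prod_swap]
      rw [← Measure.prodAssoc_prod, h3, Measure.map_map (by fun_prop) (by fun_prop)]
      rfl
    rw [← h1, hlaw, h2, expect_map _ (by fun_prop) (by fun_prop)]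
    conv_lhs => rw [← Measure.map_id (μ := τ)]
    rw [Measure.map_prod_map _ _ (by fun_prop) measurable_id,
      expect_map _ (by fun_prop) (by fun_prop)]
    rfl
  rw [hrhs]
  refine le_trans ?_ (iInf_expect_le_expect_prod _ _ (by fun_prop))
  refine le_iInf fun v => ?_
  refine (iInf₂_le (fun x => φ x v) (by fun_prop)).trans (le_of_eq ?_)
  conv_rhs => rw [← Measure.map_id (μ := τ)]
  rw [Measure.map_prod_map _ _ hp measurable_id, expect_map _ (by fun_prop) (by fun_prop)]
  rfl

end Expect

/-- A locally `L`-Lipschitz extended-real-valued function on a normed space is `L`-Lipschitz. -/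
lemma IsLocallyLipschitz.le_add {F : Type*} [NormedAddCommGroup F] [NormedSpace ℝ F] {L : ℝ≥0}
    {f : F → EReal} (hf : IsLocallyLipschitz L f) (x y : F) :
    f x ≤ f y + (((L : ℝ) * ‖x - y‖ : ℝ) : EReal) := by
  choose U hU hUL using hf
  -- The segment from `y` to `x` is cut into pieces each lying in one Lipschitz neighbourhood; the
  -- lengths of the pieces add up to `‖x - y‖`.
  set γ : unitInterval → F := fun t => y + (t : ℝ) • (x - y) with hγ
  have hγc : Continuous γ := by fun_prop
  obtain ⟨t, ht0, htm, ⟨n, hn⟩, ht⟩ :=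
    exists_monotone_Icc_subset_open_cover_unitInterval
      (c := fun z => γ ⁻¹' interior (U z))
      (fun z => isOpen_interior.preimage hγc)
      (fun s _ => Set.mem_iUnion.2 ⟨γ s, mem_interior_iff_mem_nhds.2 (hU _)⟩)
  have key : ∀ k, f (γ (t k)) ≤ f y + (((L : ℝ) * ((t k : ℝ) * ‖x - y‖) : ℝ) : EReal) := by
    intro k
    induction k with
    | zero => simp [hγ, ht0]
    | succ k ih =>
      obtain ⟨z, hz⟩ := ht k
      have hle : t k ≤ t (k + 1) := htm (Nat.le_succ k)
      have h1 := hUL z _ (interior_subset (hz (Set.right_mem_Icc.2 hle))) _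
        (interior_subset (hz (Set.left_mem_Icc.2 hle)))
      have hd : ‖γ (t (k + 1)) - γ (t k)‖ = ((t (k + 1) : ℝ) - t k) * ‖x - y‖ := by
        simp only [hγ, add_sub_add_left_eq_sub, ← sub_smul]
        rw [norm_smul, Real.norm_of_nonneg (sub_nonneg.2 hle)]
      refine h1.trans ((add_le_add_left ih _).trans (le_of_eq ?_))
      rw [add_assoc, ← EReal.coe_add, hd]
      congr 2
      ring
  simpa [hγ, hn n le_rfl] using key n

/-! ### Slices, ancestral sets and structural equations. -/

section Graph
variable {d : ℕ}

@[fun_prop]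
lemma measurable_slice (A : Finset (Fin d)) : Measurable (slice A) := by
  unfold slice
  fun_prop

lemma slice_apply (A : Finset (Fin d)) (x : EuclideanSpace ℝ (Fin d)) (i : A) :
    slice A x i = x i := rfl

lemma norm_slice_sub_le (A : Finset (Fin d)) (x y : EuclideanSpace ℝ (Fin d)) :
    ‖slice A x - slice A y‖ ≤ ‖x - y‖ := by
  rw [EuclideanSpace.norm_eq, EuclideanSpace.norm_eq]
  refine Real.sqrt_le_sqrt ?_
  simp only [PiLp.sub_apply, slice_apply]
  rw [Finset.sum_coe_sort A fun i => ‖x i - y i‖ ^ 2]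
  exact Finset.sum_le_univ_sum_of_nonneg fun i => by positivity

/-- The restriction of a vector indexed by `B` to a subset `A` of `B`. -/
noncomputable def restr {A B : Finset (Fin d)} (h : A ⊆ B) (x : EuclideanSpace ℝ B) :
    EuclideanSpace ℝ A :=
  WithLp.toLp 2 fun i : A => x ⟨i, h i.2⟩

@[fun_prop]
lemma measurable_restr {A B : Finset (Fin d)} (h : A ⊆ B) : Measurable (restr h) := by
  unfold restr
  fun_prop

lemma restr_slice {A B : Finset (Fin d)} (h : A ⊆ B) (x : EuclideanSpace ℝ (Fin d)) :
    restr h (slice B x) = slice A x := rfl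

lemma mem_parents {G : Digraph (Fin d)} {A : Finset (Fin d)} {i : Fin d} :
    i ∈ parents G A ↔ i ∉ A ∧ ∃ j ∈ A, G.Adj i j := by
  simp [parents]

open Classical in
/-- The vertices outside `T` that cannot be reached from `T`. -/
noncomputable def nondescendants (G : Digraph (Fin d)) (T : Finset (Fin d)) : Finset (Fin d) :=
  Finset.univ.filter fun i => i ∉ T ∧ ∀ t ∈ T, ¬ Relation.TransGen G.Adj t i

lemma mem_nondescendants {G : Digraph (Fin d)} {T : Finset (Fin d)} {i : Fin d} :
    i ∈ nondescendants G T ↔ i ∉ T ∧ ∀ t ∈ T, ¬ Relation.TransGen G.Adj t i := by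
  simp [nondescendants]

lemma disjoint_nondescendants (G : Digraph (Fin d)) (T : Finset (Fin d)) :
    Disjoint (nondescendants G T) T :=
  Finset.disjoint_left.2 fun _ hi => (mem_nondescendants.1 hi).1

/-- If a vertex lies in `T` or is reachable from `T`, so is every vertex to which it has an edge. -/
lemma parents_nondescendants (G : Digraph (Fin d)) (T : Finset (Fin d)) :
    parents G (nondescendants G T) = ∅ := by
  refine Finset.eq_empty_of_forall_notMem fun i hi => ?_
  obtain ⟨hi, j, hj, hij⟩ := mem_parents.1 hi
  obtain ⟨-, hj⟩ := mem_nondescendants.1 hj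
  refine hi (mem_nondescendants.2 ⟨fun hiT => hj i hiT (.single hij), fun t ht hti => ?_⟩)
  exact hj t ht (hti.tail hij)

/-- A path from `T` to a parent of `T` would project to a path in the quotient, which the edge back
into `T` closes to a cycle. -/
lemma parents_subset_nondescendants {G : Digraph (Fin d)} {T : Finset (Fin d)}
    (hT : IsAcyclic (quotientGraph G T)) : parents G T ⊆ nondescendants G T := by
  intro i hi
  obtain ⟨hiT, j, hj, hij⟩ := mem_parents.1 hi
  refine mem_nondescendants.2 ⟨hiT, fun t ht hti => ?_⟩
  set c : Fin d → Quotient (targetSetoid T) := Quotient.mk (targetSetoid T)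
  have hpath : Relation.ReflTransGen (quotientGraph G T).Adj (c t) (c i) := by
    -- Edges inside a class collapse, so the projected path may be empty; the closing edge supplies
    -- positive length.
    refine Relation.ReflTransGen.lift' c (fun a b hab => ?_) _ _ hti.to_reflTransGen
    by_cases h : c a = c b
    · change Relation.ReflTransGen _ (c a) (c b)
      rw [h]
    · exact .single ⟨h, a, b, rfl, rfl, hab⟩
  have hcj : c j = c t := Quotient.sound (Or.inr ⟨hj, ht⟩)
  have hne : c i ≠ c j := fun h => by
    rcases Quotient.exact h with h | h
    · exact hiT (h ▸ hj)
    · exact hiT h.1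
  refine hT (c t) (Relation.TransGen.tail' hpath ?_)
  rw [← hcj]
  exact ⟨hne, i, j, rfl, rfl, hij⟩

lemma parents_subset_compl (G : Digraph (Fin d)) (T : Finset (Fin d)) : parents G T ⊆ Tᶜ :=
  fun _ hi => Finset.mem_compl.2 (mem_parents.1 hi).1

/-- Solving structural equations along a sorted graph: if every coordinate in `A` is a function of
its parents and of `Z`, and the parents of `A` are functions of `Z`, then so are the coordinates
in `A`. -/
lemma exists_slice_eq {G : Digraph (Fin d)} (hG : IsSortedDAG G) {Ω ζ : Type*}
    [MeasurableSpace Ω] [MeasurableSpace ζ] {P : Measure Ω} {X : Ω → EuclideanSpace ℝ (Fin d)}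
    {Z : Ω → ζ} {A : Finset (Fin d)}
    (step : ∀ i ∈ A, ∃ F : EuclideanSpace ℝ (parents G {i}) → ζ → ℝ,
      Measurable (Function.uncurry F) ∧
        ∀ᵐ ω ∂P, X ω i = F (slice (parents G {i}) (X ω)) (Z ω))
    (bd : ∀ i ∈ parents G A, ∃ φ : ζ → ℝ, Measurable φ ∧ ∀ᵐ ω ∂P, X ω i = φ (Z ω)) :
    ∃ Φ : ζ → EuclideanSpace ℝ A, Measurable Φ ∧ ∀ᵐ ω ∂P, slice A (X ω) = Φ (Z ω) := by
  have key : ∀ i ∈ A, ∃ φ : ζ → ℝ, Measurable φ ∧ ∀ᵐ ω ∂P, X ω i = φ (Z ω) := by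
    intro i
    induction i using WellFoundedLT.induction with
    | ind i ih =>
      intro hi
      have hpar : ∀ j : parents G {i}, ∃ φ : ζ → ℝ, Measurable φ ∧ ∀ᵐ ω ∂P, X ω j = φ (Z ω) := by
        rintro ⟨j, hj⟩
        obtain ⟨-, k, hk, hjk⟩ := mem_parents.1 hj
        rw [Finset.mem_singleton] at hk
        subst hk
        by_cases hjA : j ∈ A
        · exact ih j (hG.2 _ _ hjk) hjA
        · exact bd j (mem_parents.2 ⟨hjA, k, hi, hjk⟩)
      choose φ hφ hφX using hpar
      obtain ⟨F, hF, hFX⟩ := step i hi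
      refine ⟨fun z => F (WithLp.toLp 2 fun j => φ j z) z, ?_, ?_⟩
      · exact hF.comp (Measurable.prodMk (by fun_prop) measurable_id)
      · filter_upwards [hFX, ae_all_iff.2 hφX] with ω h1 h2
        rw [h1]
        congr 1
        ext j
        exact h2 j
  choose! φ hφ hφX using key
  refine ⟨fun z => WithLp.toLp 2 fun i : A => φ i z, ?_, ?_⟩
  · have : ∀ i : A, Measurable (φ i) := fun i => hφ i i.2
    fun_prop
  · filter_upwards [ae_all_iff.2 fun i : A => hφX i i.2] with ω h
    ext i
    exact h i

end Graph

/-! ### Factorization of compatible laws and imitation along causal couplings. -/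

section Laws
variable {d : ℕ} {G : Digraph (Fin d)} {T : Finset (Fin d)}

/-- Under a `G`-compatible law, the target coordinates are a function of their parents and of noise
that is independent of every ancestral set `N` disjoint from the targets. -/
lemma IsGCompatible.exists_map_slice_eq (hG : IsSortedDAG G) {N : Finset (Fin d)}
    (hN : parents G N = ∅) (hNT : Disjoint N T) (hT : parents G T ⊆ N)
    {μ : Measure (EuclideanSpace ℝ (Fin d))}
    (hμ : IsGCompatible G μ) :
    ∃ (τ : Measure (T → ℝ)) (K : EuclideanSpace ℝ (parents G T) × (T → ℝ) → EuclideanSpace ℝ T),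
      IsProbabilityMeasure τ ∧ Measurable K ∧
      μ.map (fun x => (slice T x, slice N x)) =
        ((μ.map (slice N)).prod τ).map
          fun z => (K (restr hT z.1, z.2), z.1) := by
  obtain ⟨Ω, _, P, _, X, U, f, hX, hU, hf, rfl, hind, heq⟩ := hμ
  set UT : Ω → T → ℝ := fun ω i => U i ω
  have hUT : Measurable UT := by fun_prop
  -- As `N` has no outside parents, `X_N` is a function of the noise on `N` alone, hence independent
  -- of the noise on the disjoint set `T`.
  obtain ⟨F, hF, hFX⟩ := exists_slice_eq hG (P := P) (X := X) (Z := fun ω (i : N) => U i ω)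
    (A := N)
    (fun i hi => ⟨fun y u => f i y (u ⟨i, hi⟩),
      (hf i).comp (Measurable.prodMk (by fun_prop) (by fun_prop)), heq i⟩)
    (by simp [hN])
  obtain ⟨K, hK, hKX⟩ := exists_slice_eq hG (P := P) (X := X)
    (Z := fun ω => (slice (parents G T) (X ω), UT ω)) (A := T)
    (fun i hi => ⟨fun y z => f i y (z.2 ⟨i, hi⟩),
      (hf i).comp (Measurable.prodMk (by fun_prop) (by fun_prop)), heq i⟩)
    (fun i hi => ⟨fun z => z.1 ⟨i, hi⟩, by fun_prop, .of_forall fun ω => rfl⟩)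
  refine ⟨P.map UT, K, Measure.isProbabilityMeasure_map hUT.aemeasurable, hK, ?_⟩
  have hNX : Measurable fun ω => slice N (X ω) := by fun_prop
  have hindep : IndepFun (fun ω => slice N (X ω)) UT P := by
    have h := hind.indepFun_finset N T hNT hU
    exact (h.comp hF measurable_id).congr (hFX.mono fun ω h => h.symm) .rfl
  have hprod := (indepFun_iff_map_prod_eq_prod_map_map hNX.aemeasurable hUT.aemeasurable).1 hindep
  rw [Measure.map_map (by fun_prop) hX, Measure.map_map (by fun_prop) hX]
  change _ = Measure.map _ ((P.map fun ω => slice N (X ω)).prod _)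
  rw [← hprod, Measure.map_map (by fun_prop) (by fun_prop)]
  refine Measure.map_congr (hKX.mono fun ω h => ?_)
  simp only [Function.comp_apply, h]
  rfl

lemma prod_right_comm {α β γ : Type*} [MeasurableSpace α] [MeasurableSpace β] [MeasurableSpace γ]
    (a : Measure α) (b : Measure β) (c : Measure γ) [SFinite a] [SFinite b] [SFinite c] :
    ((a.prod b).prod c).map (fun z => ((z.1.1, z.2), z.1.2)) = (a.prod c).prod b := by
  apply MeasurableEquiv.prodAssoc.map_measurableEquiv_injective
  rw [Measure.prodAssoc_prod]
  conv_rhs => rw [← Measure.prod_swap (μ := b), ← Measure.map_id (μ := a)]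
  rw [Measure.map_prod_map _ _ measurable_id measurable_swap,
    ← Measure.prodAssoc_prod, Measure.map_map (by fun_prop) (by fun_prop),
    Measure.map_map (by fun_prop) (by fun_prop)]
  rfl

/-- Along a `G`-causal coupling, the decision of the second marginal can be imitated by one
for the first marginal. -/
lemma IsGCausalLaw.iInf_expect_le (hG : IsSortedDAG G) (hT : IsAcyclic (quotientGraph G T))
    {π : Measure (EuclideanSpace ℝ (Fin d) × EuclideanSpace ℝ (Fin d))} (hπ : IsGCausalLaw G π)
    (hπc : IsGCompatible G π.fst) {B : Type*} [MeasurableSpace B] [StandardBorelSpace B]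
    [Nonempty B] {q : EuclideanSpace ℝ T → B → EReal} (hq : Measurable (Function.uncurry q))
    {h : EuclideanSpace ℝ (parents G T) → B} (hh : Measurable h) :
    ⨅ (η : EuclideanSpace ℝ (parents G T) → B) (_ : Measurable η),
        expect π.fst (fun x => q (slice T x) (η (slice (parents G T) x))) ≤
      expect π (fun z => q (slice T z.1) (h (slice (parents G T) z.2))) := by
  obtain ⟨N, hN, hNT, hTN⟩ : ∃ N, parents G N = ∅ ∧ Disjoint N T ∧ parents G T ⊆ N :=
    ⟨_, parents_nondescendants G T, disjoint_nondescendants G T, parents_subset_nondescendants hT⟩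
  obtain ⟨τ, K, _, hK, hlaw⟩ := hπc.exists_map_slice_eq hG hN hNT hTN
  obtain ⟨Ω, _, P, _, X, X', U, g, hX, hX', hU, hg, rfl, -, hind, heq⟩ := hπ
  have hfst : (P.map fun ω => (X ω, X' ω)).fst = P.map X := by
    rw [Measure.fst, Measure.map_map measurable_fst (by fun_prop)]; rfl
  rw [hfst] at hlaw ⊢
  set UV : Ω → Fin d → ℝ := fun ω i => U i ω
  have hUV : Measurable UV := by fun_prop
  have hq' : Measurable fun z : EuclideanSpace ℝ T × B => q z.1 z.2 := hq
  have := Measure.isProbabilityMeasure_map (μ := P) hX.aemeasurable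
  have := Measure.isProbabilityMeasure_map (μ := P) hUV.aemeasurable
  have := Measure.isProbabilityMeasure_map (μ := P.map X) (measurable_slice N).aemeasurable
  -- The equations for `X'_N` involve only `X_N`, `X'_N` and the noise, because `N` contains the
  -- parents of its members.
  obtain ⟨F, hF, hFX⟩ := exists_slice_eq hG (P := P) (X := X')
    (Z := fun ω => (slice N (X ω), UV ω)) (A := N)
    (fun i hi => ⟨fun y z => g i (z.1 ⟨i, hi⟩, restr (fun j hj => by
        by_contra hjN
        have : j ∈ parents G N := by
          obtain ⟨-, k, hk, hjk⟩ := mem_parents.1 hj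
          exact mem_parents.2 ⟨hjN, i, hi, Finset.mem_singleton.1 hk ▸ hjk⟩
        simp [hN] at this) z.1, y, z.2 i),
      (hg i).comp (by fun_prop), heq i⟩)
    (by simp [hN])
  have hprod : P.map (fun ω => (X ω, UV ω)) = (P.map X).prod (P.map UV) :=
    (indepFun_iff_map_prod_eq_prod_map_map hX.aemeasurable hUV.aemeasurable).1 hind
  -- Since `U` is independent of `X`, the target noise `τ` splits off from the joint law of `(X_N,
  -- U)`.
  have hmap : ((P.map X).prod (P.map UV)).map (fun z => (slice T z.1, slice N z.1, z.2)) =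
      ((((P.map X).map (slice N)).prod (P.map UV)).prod τ).map
        fun z => (K (restr hTN z.1.1, z.2), z.1) := by
    have h1 : ((P.map X).prod (P.map UV)).map (fun z => (slice T z.1, slice N z.1, z.2)) =
        (((P.map X).map fun x => (slice T x, slice N x)).prod (P.map UV)).map
          fun z => (z.1.1, z.1.2, z.2) := by
      conv_rhs => rw [← Measure.map_id (μ := P.map UV)]
      rw [Measure.map_prod_map _ _ (by fun_prop) measurable_id,
        Measure.map_map (by fun_prop) (by fun_prop)]
      rfl
    rw [h1, hlaw, ← prod_right_comm]
    conv_lhs => rw [← Measure.map_id (μ := P.map UV)]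
    rw [Measure.map_prod_map _ _ (by fun_prop) measurable_id,
      Measure.map_map (by fun_prop) (by fun_prop)]
    conv_rhs => rw [Measure.map_map (by fun_prop) (by fun_prop)]
    rfl
  have hexp : ∀ Ψ : EuclideanSpace ℝ T × (EuclideanSpace ℝ N × (Fin d → ℝ)) → EReal,
      Measurable Ψ →
      expect ((((P.map X).map (slice N)).prod (P.map UV)).prod τ)
          (fun z => Ψ (K (restr hTN z.1.1, z.2), z.1)) =
        expect P fun ω => Ψ (slice T (X ω), slice N (X ω), UV ω) := fun Ψ hΨ => by
    refine (expect_map _ (φ := fun z : (EuclideanSpace ℝ N × (Fin d → ℝ)) × (T → ℝ) =>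
      (K (restr hTN z.1.1, z.2), z.1)) (by fun_prop) hΨ).symm.trans ?_
    rw [← hmap, ← hprod, expect_map _ (by fun_prop) hΨ, expect_map _ (by fun_prop) (by fun_prop)]
  -- Here `w = (X_N, U)`, the observed part is `X_{PA(T)}`, and `H w` is the decision
  -- `h(X'_{PA(T)})`.
  have main := iInf_expect_comp_le (((P.map X).map (slice N)).prod (P.map UV)) τ
    (p := fun w => restr hTN w.1) (by fun_prop) (H := fun w => h (restr hTN (F w))) (by fun_prop)
    hK hq
  refine (le_of_eq ?_).trans (main.trans (le_of_eq ?_))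
  · refine iInf_congr fun η => iInf_congr fun hη => ?_
    rw [hexp (fun z => q z.1 (η (restr hTN z.2.1))) (by fun_prop),
      expect_map _ hX (by fun_prop)]
    rfl
  · rw [hexp (fun z => q z.1 (h (restr hTN (F z.2)))) (by fun_prop),
      expect_map _ (by fun_prop) (by fun_prop)]
    refine expect_congr_ae (hFX.mono fun ω hω => ?_)
    simp only [← hω]
    rfl

end Laws

/-! ### Symmetry and finiteness of the causal Wasserstein distance. -/

section Wasserstein
variable {d : ℕ} {G : Digraph (Fin d)} {μ ν : Measure (EuclideanSpace ℝ (Fin d))}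

/-- The independent coupling with a `G`-compatible law is `G`-causal. -/
lemma IsGCompatible.isGCausalLaw_prod [IsProbabilityMeasure μ] (hν : IsGCompatible G ν) :
    IsGCausalLaw G (μ.prod ν) := by
  obtain ⟨Ω, _, P, _, X, U, f, hX, hU, hf, rfl, hind, heq⟩ := hν
  have hsnd : MeasurePreserving Prod.snd (μ.prod P) P := measurePreserving_snd
  -- The structural model of `ν` runs on the second factor, and `g` ignores the first vector.
  refine ⟨EuclideanSpace ℝ (Fin d) × Ω, inferInstance, μ.prod P, inferInstance, Prod.fst,
    fun ω => X ω.2, fun i ω => U i ω.2, fun i z => f i z.2.2.1 z.2.2.2, measurable_fst,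
    by fun_prop, fun i => by fun_prop, fun i => (hf i).comp (by fun_prop), ?_, ?_, ?_, fun i => ?_⟩
  · conv_rhs => rw [← Measure.map_id (μ := μ)]
    rw [Measure.map_prod_map _ _ measurable_id hX]
    rfl
  · rw [iIndepFun_iff_map_fun_eq_pi_map fun i => by fun_prop] at hind ⊢
    have hmap : ∀ {β : Type} [MeasurableSpace β] {V : Ω → β}, Measurable V →
        (μ.prod P).map (fun ω => V ω.2) = P.map V := fun hV => by
      conv_rhs => rw [← hsnd.map_eq, Measure.map_map hV measurable_snd]
      rfl
    rw [hmap (V := fun ω i => U i ω) (by fun_prop), hind]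
    congr with i : 1
    exact (hmap (hU i)).symm
  · exact indepFun_prod (μ := μ) (ν := P) measurable_id (Y := fun ω i => U i ω) (by fun_prop)
  · exact hsnd.quasiMeasurePreserving.ae (heq i)

lemma wasserstein_comm (G : Digraph (Fin d)) (μ ν : Measure (EuclideanSpace ℝ (Fin d))) :
    wasserstein G μ ν = wasserstein G ν μ := by
  have key : ∀ μ ν : Measure (EuclideanSpace ℝ (Fin d)),
      wasserstein G μ ν ≤ wasserstein G ν μ := by
    intro μ ν
    refine le_iInf₂ fun π hπ => ?_
    obtain ⟨h1, h2, h3, h4⟩ := hπ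
    have hswap : π.map Prod.swap ∈ bicausalCouplings G μ ν := by
      refine ⟨?_, ?_, h4, ?_⟩
      · rw [Measure.fst_map_swap, h2]
      · rw [Measure.snd_map_swap, h1]
      · rwa [Measure.map_map measurable_swap measurable_swap, Prod.swap_swap_eq, Measure.map_id]
    refine (iInf₂_le _ hswap).trans (le_of_eq ?_)
    rw [lintegral_map (by fun_prop) measurable_swap]
    exact lintegral_congr fun p => enorm_sub_rev _ _
  exact le_antisymm (key μ ν) (key ν μ)

/-- The independent coupling is bicausal, and its cost is at most the sum of the first moments. -/
lemma wasserstein_ne_top (hμ : μ ∈ compatibleL1 G) (hν : ν ∈ compatibleL1 G) :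
    wasserstein G μ ν ≠ ∞ := by
  obtain ⟨_, hμc, hμ1⟩ := hμ
  obtain ⟨_, hνc, hν1⟩ := hν
  refine ne_top_of_le_ne_top (b := ∫⁻ x, ‖x‖ₑ ∂μ + ∫⁻ x, ‖x‖ₑ ∂ν) (by finiteness) ?_
  have hmem : μ.prod ν ∈ bicausalCouplings G μ ν :=
    ⟨Measure.fst_prod, Measure.snd_prod, hνc.isGCausalLaw_prod, by
      rw [Measure.prod_swap]
      exact hμc.isGCausalLaw_prod⟩
  refine (iInf₂_le _ hmem).trans ((lintegral_mono fun p => enorm_sub_le).trans ?_)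
  rw [lintegral_add_left (by fun_prop), lintegral_prod_symm _ (by fun_prop),
    lintegral_prod _ (by fun_prop)]
  simp

end Wasserstein

/-! ### Lipschitz estimate for the value. -/

section Value
variable {d : ℕ} {G : Digraph (Fin d)} {T : Finset (Fin d)} {κ : Type} [Fintype κ]
  {Q : EuclideanSpace ℝ T → EuclideanSpace ℝ κ → EReal} {L : ℝ≥0}

/-- A `G`-causal function is a measurable function of the parents of `T`. -/
lemma IsGCausalFun.exists_eq_comp_slice {β : Type*} [MeasurableSpace β]
    {h : EuclideanSpace ℝ (Tᶜ : Finset (Fin d)) → β} (hm : Measurable h)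
    (hc : IsGCausalFun G T h) :
    ∃ h' : EuclideanSpace ℝ (parents G T) → β, Measurable h' ∧
      ∀ x, h (slice Tᶜ x) = h' (slice (parents G T) x) := by
  classical
  -- Coordinates outside `PA(T)` are filled with `0`, which causality makes harmless.
  refine ⟨fun p => h (WithLp.toLp 2 fun i => if hi : (i : Fin d) ∈ parents G T then p ⟨i, hi⟩ else 0),
    hm.comp ?_, fun x => hc _ _ fun i hi => ?_⟩
  · refine (WithLp.measurable_toLp 2 _).comp (measurable_pi_lambda _ fun i => ?_)
    split_ifs <;> fun_prop
  · simp [hi, slice_apply]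

/-- Imitating `h` on the first marginal costs nothing by `IsGCausalLaw.iInf_expect_le`; the error
comes only from exchanging the targets under `π`. -/
lemma value_le_expect_add (hG : IsSortedDAG G) (hT : IsAcyclic (quotientGraph G T))
    (hQm : Measurable (Function.uncurry Q)) (hQL : ∀ h, IsLocallyLipschitz L fun x => Q x h)
    {π : Measure (EuclideanSpace ℝ (Fin d) × EuclideanSpace ℝ (Fin d))} (hπ : IsGCausalLaw G π)
    (hπc : IsGCompatible G π.fst) (hfin : ∫⁻ z, ‖z.1 - z.2‖ₑ ∂π ≠ ∞)
    {h : EuclideanSpace ℝ (Tᶜ : Finset (Fin d)) → EuclideanSpace ℝ κ} (hm : Measurable h)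
    (hc : IsGCausalFun G T h) :
    value G T Q π.fst ≤ expect π.snd (fun x => Q (slice T x) (h (slice Tᶜ x))) +
      ((L * ∫⁻ z, ‖z.1 - z.2‖ₑ ∂π : ℝ≥0∞) : EReal) := by
  obtain ⟨h', hm', hh'⟩ := hc.exists_eq_comp_slice hm
  have hQ' : Measurable fun z : EuclideanSpace ℝ T × EuclideanSpace ℝ κ => Q z.1 z.2 := hQm
  have hval : value G T Q π.fst ≤
      ⨅ (η : EuclideanSpace ℝ (parents G T) → EuclideanSpace ℝ κ) (_ : Measurable η),
        expect π.fst (fun x => Q (slice T x) (η (slice (parents G T) x))) :=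
    le_iInf₂ fun η hη => iInf₂_le (fun y => η (restr (parents_subset_compl G T) y))
      ⟨by fun_prop, fun x y hxy => congrArg η (by ext i; exact hxy _ i.2)⟩
  refine hval.trans ((hπ.iInf_expect_le hG hT hπc hQm hm').trans ?_)
  have hcost : ∫⁻ z, ((L * ‖z.1 - z.2‖₊ : ℝ≥0) : ℝ≥0∞) ∂π = L * ∫⁻ z, ‖z.1 - z.2‖ₑ ∂π := by
    rw [← lintegral_const_mul _ (by fun_prop)]
    exact lintegral_congr fun z => by push_cast; rfl
  have hsnd : expect π.snd (fun x => Q (slice T x) (h (slice Tᶜ x))) =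
      expect π fun z => Q (slice T z.2) (h' (slice (parents G T) z.2)) := by
    simp only [hh']
    exact expect_map π measurable_snd (by fun_prop)
  rw [hsnd, ← hcost]
  refine expect_le_expect_add (by fun_prop) (by fun_prop) ?_ fun z => ?_
  · rw [hcost]
    finiteness
  · refine ((hQL _).le_add _ (slice T z.2)).trans (add_le_add_right ?_ _)
    rw [EReal.coe_le_coe_iff]
    push_cast
    gcongr
    exact norm_slice_sub_le T z.1 z.2

/-- The value of a `G`-causal optimization problem is `L`-Lipschitz in the law. -/
lemma value_le_value_add (hG : IsSortedDAG G) (hT : IsAcyclic (quotientGraph G T))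
    (hQm : Measurable (Function.uncurry Q)) (hQL : ∀ h, IsLocallyLipschitz L fun x => Q x h)
    {μ ν : Measure (EuclideanSpace ℝ (Fin d))} (hμ : μ ∈ compatibleL1 G)
    (hν : ν ∈ compatibleL1 G) :
    value G T Q μ ≤ value G T Q ν + ((L * wasserstein G μ ν : ℝ≥0∞) : EReal) := by
  have hWfin := wasserstein_ne_top hμ hν
  have hLW : (L * wasserstein G μ ν : ℝ≥0∞) ≠ ∞ := by finiteness
  have hbot := EReal.coe_ennreal_ne_bot (L * wasserstein G μ ν)
  have htop : ((L * wasserstein G μ ν : ℝ≥0∞) : EReal) ≠ ⊤ := mt EReal.coe_ennreal_eq_top_iff.1 hLW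
  -- The finite error is moved to the left so that the infimum over `h` stands alone on the right.
  rw [← EReal.sub_le_iff_le_add (.inl hbot) (.inl htop)]
  refine le_iInf₂ fun h hh => ?_
  rw [EReal.sub_le_iff_le_add (.inl hbot) (.inl htop)]
  have hπ : ∀ r > wasserstein G μ ν,
      value G T Q μ ≤ expect ν (fun x => Q (slice T x) (h (slice Tᶜ x))) +
        ((L * r : ℝ≥0∞) : EReal) := by
    intro r hr
    obtain ⟨π, hr⟩ := iInf_lt_iff.1 hr
    obtain ⟨⟨rfl, rfl, hπ, -⟩, hlt⟩ := iInf_lt_iff.1 hr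
    refine (value_le_expect_add hG hT hQm hQL hπ hμ.2.1 hlt.ne_top hh.1 hh.2).trans ?_
    gcongr
    exact EReal.coe_ennreal_le_coe_ennreal_iff.2 (by gcongr)
  -- No optimal coupling is needed: the bound holds for all `r > W_G(μ, ν)`, and `r` decreases to
  -- the infimum.
  have hlim : Tendsto (fun r : ℝ≥0∞ =>
      expect ν (fun x => Q (slice T x) (h (slice Tᶜ x))) + ((L * r : ℝ≥0∞) : EReal))
      (𝓝[>] wasserstein G μ ν)
      (𝓝 (expect ν (fun x => Q (slice T x) (h (slice Tᶜ x))) +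
        ((L * wasserstein G μ ν : ℝ≥0∞) : EReal))) := by
    have h1 : Tendsto (fun r : ℝ≥0∞ => ((L * r : ℝ≥0∞) : EReal)) (𝓝[>] wasserstein G μ ν)
        (𝓝 ((L * wasserstein G μ ν : ℝ≥0∞) : EReal)) :=
      (continuous_coe_ennreal_ereal.tendsto _).comp
        (((ENNReal.continuous_const_mul ENNReal.coe_ne_top).tendsto _).mono_left
          nhdsWithin_le_nhds)
    exact (EReal.continuousAt_add (.inr hbot) (.inr htop)).tendsto.comp
      (tendsto_const_nhds.prodMk_nhds h1)
  have : (𝓝[>] wasserstein G μ ν).NeBot := nhdsGT_neBot_of_exists_gt ⟨∞, hWfin.lt_top⟩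
  exact ge_of_tendsto hlim (eventually_mem_nhdsWithin.mono hπ)

end Value

end GCausal

theorem mainTheorem1 {d : ℕ} (G : Digraph (Fin d)) (hG : GCausal.IsSortedDAG G)
    (T : Finset (Fin d)) (hT : GCausal.IsAcyclic (GCausal.quotientGraph G T))
    {κ : Type} [Fintype κ] (Q : EuclideanSpace ℝ T → EuclideanSpace ℝ κ → EReal)
    (hQm : Measurable (Function.uncurry Q)) (L : ℝ≥0)
    (hQL : ∀ h, GCausal.IsLocallyLipschitz L fun x => Q x h)
    (hQc : ∀ x, GCausal.IsConvex (Q x)) :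
    (∀ μ ∈ GCausal.compatibleL1 G,
      Tendsto (GCausal.value G T Q)
        (comap (fun ν => GCausal.wasserstein G μ ν) (𝓝 0) ⊓ 𝓟 (GCausal.compatibleL1 G))
        (𝓝 (GCausal.value G T Q μ))) ∧
    ∀ μ ∈ GCausal.compatibleL1 G, ∀ ν ∈ GCausal.compatibleL1 G,
      GCausal.value G T Q μ ≤
          GCausal.value G T Q ν + ((L * GCausal.wasserstein G μ ν : ℝ≥0∞) : EReal) ∧
        GCausal.value G T Q ν ≤
          GCausal.value G T Q μ + ((L * GCausal.wasserstein G μ ν : ℝ≥0∞) : EReal) := by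
  have hle : ∀ μ ∈ GCausal.compatibleL1 G, ∀ ν ∈ GCausal.compatibleL1 G,
      GCausal.value G T Q μ ≤
          GCausal.value G T Q ν + ((L * GCausal.wasserstein G μ ν : ℝ≥0∞) : EReal) ∧
        GCausal.value G T Q ν ≤
          GCausal.value G T Q μ + ((L * GCausal.wasserstein G μ ν : ℝ≥0∞) : EReal) :=
    fun μ hμ ν hν => ⟨GCausal.value_le_value_add hG hT hQm hQL hμ hν, by
      rw [GCausal.wasserstein_comm]
      exact GCausal.value_le_value_add hG hT hQm hQL hν hμ⟩
  refine ⟨fun μ hμ => ?_, hle⟩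
  set l := comap (fun ν => GCausal.wasserstein G μ ν) (𝓝 0) ⊓ 𝓟 (GCausal.compatibleL1 G)
  have hmem : ∀ᶠ ν in l, ν ∈ GCausal.compatibleL1 G :=
    (eventually_principal.2 fun _ h => h).filter_mono inf_le_right
  have hW : Tendsto (fun ν => ((L * GCausal.wasserstein G μ ν : ℝ≥0∞) : EReal)) l (𝓝 0) := by
    have h0 : Tendsto (fun ν => GCausal.wasserstein G μ ν) l (𝓝 0) :=
      tendsto_comap.mono_left inf_le_left
    have h1 := (continuous_coe_ennreal_ereal.tendsto _).comp
      (((ENNReal.continuous_const_mul (a := (L : ℝ≥0∞)) ENNReal.coe_ne_top).tendsto 0).comp h0)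
    rwa [mul_zero, EReal.coe_ennreal_zero] at h1
  -- Addition on `EReal` is continuous at `(a, 0)` even for `a = ±∞`, so infinite values need no
  -- separate case.
  have hup : Tendsto (fun ν => GCausal.value G T Q μ +
      ((L * GCausal.wasserstein G μ ν : ℝ≥0∞) : EReal)) l (𝓝 (GCausal.value G T Q μ)) := by
    have h2 := (EReal.continuousAt_add (p := (GCausal.value G T Q μ, 0)) (.inr (by simp))
      (.inr (by simp))).tendsto.comp (tendsto_const_nhds.prodMk_nhds hW)
    rwa [add_zero] at h2
  have hlow : Tendsto (fun ν => GCausal.value G T Q μ -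
      ((L * GCausal.wasserstein G μ ν : ℝ≥0∞) : EReal)) l (𝓝 (GCausal.value G T Q μ)) := by
    have h3 : Tendsto (fun ν => -((L * GCausal.wasserstein G μ ν : ℝ≥0∞) : EReal)) l (𝓝 0) := by
      simpa [Function.comp_def] using (continuous_neg.tendsto (0 : EReal)).comp hW
    have h2 := (EReal.continuousAt_add (p := (GCausal.value G T Q μ, 0)) (.inr (by simp))
      (.inr (by simp))).tendsto.comp (tendsto_const_nhds.prodMk_nhds h3)
    rwa [add_zero] at h2
  exact tendsto_of_tendsto_of_tendsto_of_le_of_le' hlow hup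
    (hmem.mono fun ν hν => EReal.sub_le_of_le_add (hle μ hμ ν hν).1)
    (hmem.mono fun ν hν => (hle μ hμ ν hν).2)
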